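/- Let $n\in\mathbb N$, let $\mathcal T(\cdot\mid x)$ be a Markov kernel on $\mathbb R^n$ (Euclidean norm), $\mu_0$ a probability measure on $\mathbb R^n$, and $\Delta t>0$. Let $\mu_t$ be the law at step $t\in\mathbb N$ of the Markov chain with kernel $\mathcal T$ and initial law $\mu_0$. For probability measures $\mu,\nu$ on $\mathbb R^n$ put $$W_2(\mu,\nu)=\Bigl(\inf_{\pi}\int\|x-y\|^2\,d\pi(x,y)\Bigr)^{1/2}\in[0,\infty],$$ the infimum being over all couplings $\pi$ of $\mu$ and $\nu$. Consider a surrogate of one of two kinds, started from the same initial law $\hat\mu_0=\mu_0$, with law $\hat\mu_t$ at step $t$. * Deterministic: $\hat x_t=S(\hat x_{t-1})$ for a map $S:\mathbb R^n\to\mathbb R^n$, with $$\epsilon=\epsilon_{det}=\sup_x W_2(\mathcal T(\cdot\mid x),\delta_{S(x)}),\qquad L=L_{det}=\sup_{x\ne x'}\frac{\|S(x)-S(x')\|}{\|x-x'\|}.$$ * Probabilistic: $\hat x_t\sim p(\cdot\mid\hat x_{t-1})$ for a Markov kernel $p$ on $\mathbb R^n$ such that every $p(\cdot\mid x)$ has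 finite second moment, with $$\epsilon=\epsilon_{prob}=\sup_x W_2(\mathcal T(\cdot\mid x),p(\cdot\mid x)),\qquad L=L_{prob}=\sup_{x\neq x'}\frac{W_2(p(\cdot\mid x),p(\cdot\mid x'))}{\|x-x'\|}.$$ (1) In both cases, if $1<L<\infty$, then for every $t\in\mathbb N$ $$W_2(\mu_t,\hat\mu_t)\le\epsilon\,\frac{L^t-1}{L-1}\qquad\text{and}\qquad W_2(\mu_t,\hat\mu_t)\le\frac{e^{\Lambda T}-1}{\Lambda}\,\bar\epsilon,$$ where $\Lambda=\frac{\ln L}{\Delta t}$, $\bar\epsilon=\frac{\epsilon}{\Delta t}$ and $T=t\,\Delta t$ (with the convention $0\cdot\infty=0$ if $\epsilon=\infty$). (2) Let $V^*=\sup_x\inf_{y\in\mathbb R^n}W_2(\mathcal T(\cdot\mid x),\delta_y)$ be the intrinsic spread of $\mathcal T$. Then $\epsilon_{det}\ge V^*$ for every map $S:\mathbb R^n\to\mathbb R^n$. If $\mathcal T$ is non-degenerate, i.e. $\mathcal T(\cdot\mid x)$ has positive total variance $\mathbb E\|z-\mathbb E z\|^2$ for at least one $x$ (counted as $+\infty$,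 hence positive, if the second moment is infinite), then $V^*>0$. (3) If every $\mathcal T(\cdot\mid x)$ has finite second moment, then $\epsilon_{prob}$ can be made arbitrarily small: for every $\delta>0$ there is a Markov kernel $p$ on $\mathbb R^n$, all of whose laws $p(\cdot\mid x)$ have finite second moment, with $\epsilon_{prob}<\delta$. -/

import Mathlib

open MeasureTheory ProbabilityTheory
open scoped ENNReal

namespace Autoregressive

/-- The state space `ℝⁿ` with its Euclidean norm. -/
abbrev State (n : ℕ) : Type := EuclideanSpace ℝ (Fin n)

/-- The couplings of `μ` and `ν`: measures on the product whose marginals are `μ` and `ν`. -/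
def couplings {n : ℕ} (μ ν : Measure (State n)) : Set (Measure (State n × State n)) :=
  {π | π.map Prod.fst = μ ∧ π.map Prod.snd = ν}

/-- The 2-Wasserstein distance, with values in `[0, ∞]`
(it is finite on measures with finite second moments). -/
noncomputable def W2 {n : ℕ} (μ ν : Measure (State n)) : ℝ≥0∞ :=
  (⨅ π ∈ couplings μ ν, ∫⁻ z, ‖z.1 - z.2‖ₑ ^ 2 ∂π) ^ (1 / 2 : ℝ)

/-- The marginal law at step `t` of the Markov chain with transition kernel `κ`
and initial law `μ₀`. -/
noncomputable def marginal {n : ℕ} (κ : Kernel (State n) (State n)) (μ₀ : Measure (State n)) :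
    ℕ → Measure (State n)
  | 0 => μ₀
  | t + 1 => (marginal κ μ₀ t).bind κ

/-- The marginal law at step `t` of the deterministic recursion `x_t = S (x_{t-1})`
with initial law `μ₀`. -/
noncomputable def marginalDet {n : ℕ} (S : State n → State n) (μ₀ : Measure (State n)) :
    ℕ → Measure (State n)
  | 0 => μ₀
  | t + 1 => (marginalDet S μ₀ t).map S

/-- The intrinsic spread `V* = sup_x inf_y W₂(T(·|x), δ_y)` of a kernel. -/
noncomputable def intrinsicSpread {n : ℕ} (T : Kernel (State n) (State n)) : ℝ≥0∞ :=
  ⨆ x, ⨅ y, W2 (T x) (Measure.dirac y)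

/-- The total variance `E ‖z - E z‖²` (the trace of the covariance matrix) of a law. -/
noncomputable def totalVariance {n : ℕ} (μ : Measure (State n)) : ℝ≥0∞ :=
  ∫⁻ z, ‖z - ∫ w, w ∂μ‖ₑ ^ 2 ∂μ

/-- The one-step error `sup_x W₂(T(·|x), δ_{S x})` of a deterministic surrogate. -/
noncomputable def errDet {n : ℕ} (T : Kernel (State n) (State n)) (S : State n → State n) :
    ℝ≥0∞ :=
  ⨆ x, W2 (T x) (Measure.dirac (S x))

/-- The one-step error `sup_x W₂(T(·|x), p(·|x))` of a probabilistic surrogate. -/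
noncomputable def errProb {n : ℕ} (T p : Kernel (State n) (State n)) : ℝ≥0∞ :=
  ⨆ x, W2 (T x) (p x)

/-- The Lipschitz constant `sup_{x ≠ x'} ‖S x - S x'‖ / ‖x - x'‖`. -/
noncomputable def lipDet {n : ℕ} (S : State n → State n) : ℝ≥0∞ :=
  ⨆ (x : State n) (x' : State n) (_ : x ≠ x'), ‖S x - S x'‖ₑ / ‖x - x'‖ₑ

/-- The Wasserstein-Lipschitz constant `sup_{x ≠ x'} W₂(p(·|x), p(·|x')) / ‖x - x'‖`. -/
noncomputable def lipProb {n : ℕ} (p : Kernel (State n) (State n)) : ℝ≥0∞ :=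
  ⨆ (x : State n) (x' : State n) (_ : x ≠ x'), W2 (p x) (p x') / ‖x - x'‖ₑ

/-- The rate `Λ = ln L / Δt`. -/
noncomputable def growthRate (L Δt : ℝ) : ℝ := Real.log L / Δt

end Autoregressive

open Autoregressive

namespace Autoregressive

/-! The error bounds come from the recursion `W2 (μ.bind T) (ν.bind p) ≤ ε + L * W2 μ ν`
(`W2_bind_le`), summed as a geometric series. To prove it, take a coupling `π` of `μ` and `ν`. By
the triangle inequality, `T x` and `p y` are within `ε + L‖x - y‖`. Mixing nearly optimal couplings
of `T x` and `p y` over `π`, then applying Minkowski in `L²(π)`, gives the claim.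

The difficulty is to choose these couplings measurably in `(x, y)` (`exists_coupling_kernel`). A
countable family of candidates suffices. A coupling smeared over small cells has a density with
respect to the product of its marginals, constant on pairs of cells. This density is approximated
from below by members of a countable family of step functions, and the missing mass is restored by a
multiple of the product of the residual marginals. Finite second moments make the cost of this
correction vanish in the limit. Each candidate depends measurably on the two laws, so taking the
first admissible index is measurable.

The spread bound holds because the only couplings with a Dirac mass are concentrated on a slice, so
`W2 μ δ_y` dominates the `L²` distance to the constant `y`, which controls the standard deviation.
The kernel `T` is its own surrogate with zero error. -/

lemma sq_rpow_half (a : ℝ≥0∞) : (a ^ 2) ^ (1 / 2 : ℝ) = a := by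
  rw [← ENNReal.rpow_two, ← ENNReal.rpow_mul]; norm_num

lemma rpow_half_sq (a : ℝ≥0∞) : (a ^ (1 / 2 : ℝ)) ^ 2 = a := by
  rw [← ENNReal.rpow_two, ← ENNReal.rpow_mul]; norm_num

/-- Minkowski's inequality in `L²` for `ℝ≥0∞`-valued functions. -/
lemma lintegral_sq_add_le {α : Type*} [MeasurableSpace α] {μ : Measure α} {f g : α → ℝ≥0∞}
    (hf : Measurable f) (hg : Measurable g) :
    (∫⁻ a, (f a + g a) ^ 2 ∂μ) ^ (1 / 2 : ℝ) ≤
      (∫⁻ a, f a ^ 2 ∂μ) ^ (1 / 2 : ℝ) + (∫⁻ a, g a ^ 2 ∂μ) ^ (1 / 2 : ℝ) := by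
  have h := ENNReal.lintegral_Lp_add_le (μ := μ) (p := 2) hf.aemeasurable hg.aemeasurable
    (by norm_num)
  simpa only [ENNReal.rpow_two, Pi.add_apply] using h

lemma lintegral_sq_add_const_le {α : Type*} [MeasurableSpace α] {μ : Measure α}
    [IsProbabilityMeasure μ] {f : α → ℝ≥0∞} (hf : Measurable f) (c : ℝ≥0∞) :
    (∫⁻ a, (f a + c) ^ 2 ∂μ) ^ (1 / 2 : ℝ) ≤ (∫⁻ a, f a ^ 2 ∂μ) ^ (1 / 2 : ℝ) + c := by
  have h := lintegral_sq_add_le (μ := μ) hf (measurable_const (a := c))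
  rwa [lintegral_const, measure_univ, mul_one, sq_rpow_half] at h

lemma add_sq_le (a b : ℝ≥0∞) : (a + b) ^ 2 ≤ 2 * (a ^ 2 + b ^ 2) := by
  have := ENNReal.rpow_add_le_mul_rpow_add_rpow a b (p := 2) (by norm_num)
  simp only [ENNReal.rpow_two] at this
  refine this.trans_eq ?_
  norm_num

/-! ### Couplings and basic properties of the Wasserstein distance. -/

variable {n : ℕ}

lemma measurable_cost : Measurable fun z : State n × State n => ‖z.1 - z.2‖ₑ ^ 2 := by fun_prop

lemma isProbabilityMeasure_of_mem_couplings {μ ν : Measure (State n)} [IsProbabilityMeasure μ]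
    {π : Measure (State n × State n)} (h : π ∈ couplings μ ν) : IsProbabilityMeasure π := by
  refine ⟨?_⟩
  have := congrArg (fun m => m Set.univ) h.1
  simpa [Measure.map_apply measurable_fst MeasurableSet.univ] using this

lemma W2_le_of_mem_couplings {μ ν : Measure (State n)} {π : Measure (State n × State n)}
    (h : π ∈ couplings μ ν) : W2 μ ν ≤ (∫⁻ z, ‖z.1 - z.2‖ₑ ^ 2 ∂π) ^ (1 / 2 : ℝ) :=
  ENNReal.rpow_le_rpow (iInf₂_le π h) (by norm_num)

lemma W2_sq (μ ν : Measure (State n)) :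
    W2 μ ν ^ 2 = ⨅ π ∈ couplings μ ν, ∫⁻ z, ‖z.1 - z.2‖ₑ ^ 2 ∂π := by
  rw [W2, rpow_half_sq]

lemma exists_coupling_of_W2_sq_lt {μ ν : Measure (State n)} {c : ℝ≥0∞} (h : W2 μ ν ^ 2 < c) :
    ∃ π ∈ couplings μ ν, ∫⁻ z, ‖z.1 - z.2‖ₑ ^ 2 ∂π < c := by
  rw [W2_sq] at h
  simpa only [iInf_lt_iff, exists_prop] using h

lemma exists_coupling_of_W2_lt {μ ν : Measure (State n)} {c : ℝ≥0∞} (h : W2 μ ν < c) :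
    ∃ π ∈ couplings μ ν, (∫⁻ z, ‖z.1 - z.2‖ₑ ^ 2 ∂π) ^ (1 / 2 : ℝ) < c := by
  obtain ⟨π, hπ, hc⟩ := exists_coupling_of_W2_sq_lt (ENNReal.pow_lt_pow_left two_ne_zero h)
  refine ⟨π, hπ, ?_⟩
  have := ENNReal.rpow_lt_rpow hc (z := 1 / 2) (by norm_num)
  rwa [sq_rpow_half] at this

lemma W2_self (μ : Measure (State n)) : W2 μ μ = 0 := by
  have h : μ.map (fun x => (x, x)) ∈ couplings μ μ := by
    constructor <;> rw [Measure.map_map (by fun_prop) (by fun_prop)] <;> exact Measure.map_id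
  refine le_antisymm ((W2_le_of_mem_couplings h).trans ?_) zero_le
  rw [lintegral_map measurable_cost (by fun_prop)]
  simp

lemma W2_dirac_dirac (x y : State n) :
    W2 (Measure.dirac x) (Measure.dirac y) ≤ ‖x - y‖ₑ := by
  have h : Measure.dirac (x, y) ∈ couplings (Measure.dirac x) (Measure.dirac y) := by
    constructor
    · exact Measure.map_dirac' measurable_fst _
    · exact Measure.map_dirac' measurable_snd _
  refine (W2_le_of_mem_couplings h).trans ?_
  rw [lintegral_dirac, sq_rpow_half]

/-- A coupling whose second marginal is `δ_y` lives almost everywhere on `z.2 = y`, so its cost is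
determined by its first marginal. -/
lemma W2_dirac (μ : Measure (State n)) (y : State n) :
    (∫⁻ z, ‖z - y‖ₑ ^ 2 ∂μ) ^ (1 / 2 : ℝ) ≤ W2 μ (Measure.dirac y) := by
  refine ENNReal.rpow_le_rpow (le_iInf₂ fun π hπ => ?_) (by norm_num)
  have hy : ∀ᵐ z ∂π, z.2 = y := by
    have h : ∀ᵐ w ∂(π.map Prod.snd), w = y := by
      rw [hπ.2, ae_dirac_eq]
      rfl
    exact ae_of_ae_map measurable_snd.aemeasurable h
  rw [← hπ.1, lintegral_map (by fun_prop) measurable_fst]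
  refine lintegral_mono_ae ?_
  filter_upwards [hy] with z hz
  rw [hz]

/-- The gluing lemma, as the triangle inequality for the Wasserstein distance. -/
lemma W2_triangle (μ ν ρ : Measure (State n)) [IsProbabilityMeasure μ] [IsProbabilityMeasure ν] :
    W2 μ ρ ≤ W2 μ ν + W2 ν ρ := by
  refine ENNReal.le_of_forall_pos_le_add fun ε hε htop => ?_
  have hε' : (ε / 2 : ℝ≥0∞) ≠ 0 := by simp [hε.ne']
  obtain ⟨h1, h2⟩ := ENNReal.add_ne_top.1 htop.ne
  obtain ⟨π₁, hπ₁, hc₁⟩ := exists_coupling_of_W2_lt (ENNReal.lt_add_right h1 hε')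
  obtain ⟨π₂, hπ₂, hc₂⟩ := exists_coupling_of_W2_lt (ENNReal.lt_add_right h2 hε')
  have := isProbabilityMeasure_of_mem_couplings hπ₁
  have := isProbabilityMeasure_of_mem_couplings hπ₂
  -- Swapping makes `ν` the first marginal of both couplings, so that both can be disintegrated over
  -- it.
  set σ := π₁.map Prod.swap with hσ
  have : IsProbabilityMeasure σ := Measure.isProbabilityMeasure_map measurable_swap.aemeasurable
  have hσ1 : σ.fst = ν := by
    rw [Measure.fst, hσ, Measure.map_map measurable_fst measurable_swap]; exact hπ₁.2
  have hσ2 : π₂.fst = ν := hπ₂.1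
  have e1 : ν ⊗ₘ σ.condKernel = σ := by
    conv_lhs => rw [← hσ1]
    exact σ.disintegrate _
  have e2 : ν ⊗ₘ π₂.condKernel = π₂ := by
    conv_lhs => rw [← hσ2]
    exact π₂.disintegrate _
  -- The gluing: the outer two points are drawn conditionally independently given the middle point,
  -- which is the first coordinate of `τ`.
  set τ := ν ⊗ₘ (σ.condKernel ×ₖ π₂.condKernel) with hτ
  have m1 : τ.map (fun z => (z.2.1, z.1)) = π₁ := by
    have : τ.map (Prod.map id Prod.fst) = σ := by
      rw [hτ, ← Measure.compProd_map measurable_fst, ← Kernel.fst_eq, Kernel.fst_prod, e1]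
    have h3 := congrArg (Measure.map Prod.swap) this
    rw [hσ, Measure.map_map (by fun_prop) (by fun_prop),
      Measure.map_map (by fun_prop) (by fun_prop)] at h3
    rw [Prod.swap_swap_eq, Measure.map_id] at h3
    exact h3
  have m2 : τ.map (fun z => (z.1, z.2.2)) = π₂ := by
    have : τ.map (Prod.map id Prod.snd) = π₂ := by
      rw [hτ, ← Measure.compProd_map measurable_snd, ← Kernel.snd_eq, Kernel.snd_prod, e2]
    exact this
  have hmem : τ.map (fun z => (z.2.1, z.2.2)) ∈ couplings μ ρ := by
    constructor
    · rw [← hπ₁.1, ← m1, Measure.map_map (by fun_prop) (by fun_prop),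
        Measure.map_map (by fun_prop) (by fun_prop)]
      rfl
    · rw [← hπ₂.2, ← m2, Measure.map_map (by fun_prop) (by fun_prop),
        Measure.map_map (by fun_prop) (by fun_prop)]
      rfl
  have i1 : ∫⁻ z, ‖z.1 - z.2‖ₑ ^ 2 ∂π₁ = ∫⁻ z, ‖z.2.1 - z.1‖ₑ ^ 2 ∂τ := by
    rw [← m1, lintegral_map (by fun_prop) (by fun_prop)]
  have i2 : ∫⁻ z, ‖z.1 - z.2‖ₑ ^ 2 ∂π₂ = ∫⁻ z, ‖z.1 - z.2.2‖ₑ ^ 2 ∂τ := by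
    rw [← m2, lintegral_map (by fun_prop) (by fun_prop)]
  calc W2 μ ρ ≤ _ := W2_le_of_mem_couplings hmem
    _ = (∫⁻ z, ‖z.2.1 - z.2.2‖ₑ ^ 2 ∂τ) ^ (1 / 2 : ℝ) := by
      rw [lintegral_map (by fun_prop) (by fun_prop)]
    _ ≤ (∫⁻ z, (‖z.2.1 - z.1‖ₑ + ‖z.1 - z.2.2‖ₑ) ^ 2 ∂τ) ^ (1 / 2 : ℝ) := by
      gcongr with z
      calc ‖z.2.1 - z.2.2‖ₑ = ‖(z.2.1 - z.1) + (z.1 - z.2.2)‖ₑ := by congr 1; abel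
        _ ≤ _ := enorm_add_le _ _
    _ ≤ _ := lintegral_sq_add_le (by fun_prop) (by fun_prop)
    _ ≤ (W2 μ ν + ε / 2) + (W2 ν ρ + ε / 2) := by
      rw [← i1, ← i2]; exact add_le_add hc₁.le hc₂.le
    _ = W2 μ ν + W2 ν ρ + ε := by
      rw [add_add_add_comm, ENNReal.add_halves]

lemma lintegral_sq_lt_top_of_memLp {μ : Measure (State n)} (h : MemLp id 2 μ) :
    ∫⁻ z, ‖z‖ₑ ^ 2 ∂μ ≠ ⊤ := by
  have := lintegral_rpow_enorm_lt_top_of_eLpNorm_lt_top (by norm_num) (by norm_num) h.2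
  simpa using this.ne

/-- A law at finite distance from one with finite second moment has finite second moment. -/
lemma lintegral_sq_ne_top_of_W2 {μ ν : Measure (State n)} (h : W2 μ ν ≠ ⊤)
    (hν : ∫⁻ z, ‖z‖ₑ ^ 2 ∂ν ≠ ⊤) : ∫⁻ z, ‖z‖ₑ ^ 2 ∂μ ≠ ⊤ := by
  obtain ⟨π, hπ, hc⟩ := exists_coupling_of_W2_sq_lt (ENNReal.pow_lt_top h.lt_top (n := 2))
  have e1 : ∫⁻ z, ‖z‖ₑ ^ 2 ∂μ = ∫⁻ z, ‖z.1‖ₑ ^ 2 ∂π := by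
    rw [← hπ.1, lintegral_map (by fun_prop) (by fun_prop)]
  have e2 : ∫⁻ z, ‖z‖ₑ ^ 2 ∂ν = ∫⁻ z, ‖z.2‖ₑ ^ 2 ∂π := by
    rw [← hπ.2, lintegral_map (by fun_prop) (by fun_prop)]
  rw [e1]
  refine ne_top_of_le_ne_top (b := ∫⁻ z, 2 * (‖z.1 - z.2‖ₑ ^ 2 + ‖z.2‖ₑ ^ 2) ∂π) ?_ ?_
  · rw [lintegral_const_mul _ (by fun_prop), lintegral_add_left (by fun_prop), ← e2]
    exact ENNReal.mul_ne_top (by norm_num) (ENNReal.add_ne_top.2 ⟨hc.ne, hν⟩)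
  · refine lintegral_mono fun z => ?_
    refine le_trans ?_ (add_sq_le _ _)
    gcongr
    calc ‖z.1‖ₑ = ‖(z.1 - z.2) + z.2‖ₑ := by congr 1; abel
      _ ≤ _ := enorm_add_le _ _

/-! ### Total variance and intrinsic spread. -/

/-- The mean lies within `‖z - y‖` in `L¹`, hence in `L²`, of `y`; Minkowski then gives the factor
2, which is not sharp but is enough for positivity. -/
lemma totalVariance_rpow_half_le (μ : Measure (State n)) [IsProbabilityMeasure μ] (y : State n) :
    totalVariance μ ^ (1 / 2 : ℝ) ≤ 2 * (∫⁻ z, ‖z - y‖ₑ ^ 2 ∂μ) ^ (1 / 2 : ℝ) := by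
  -- Without a finite second moment the mean may be the default value 0 of the Bochner integral, but
  -- then the right side is infinite.
  by_cases htop : (∫⁻ z, ‖z - y‖ₑ ^ 2 ∂μ) ^ (1 / 2 : ℝ) = ⊤
  · rw [htop]; simp
  have hL1 : ∫⁻ z, ‖z - y‖ₑ ∂μ ≤ (∫⁻ z, ‖z - y‖ₑ ^ 2 ∂μ) ^ (1 / 2 : ℝ) := by
    have := eLpNorm_le_eLpNorm_of_exponent_le (μ := μ) (p := 1) (q := 2) (by norm_num)
      (f := fun z : State n => z - y) (by fun_prop)
    simpa [eLpNorm_one_eq_lintegral_enorm, eLpNorm_eq_lintegral_rpow_enorm_toReal] using this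
  have hint : Integrable (fun z : State n => z - y) μ :=
    ⟨by fun_prop, hL1.trans_lt (lt_top_iff_ne_top.2 htop)⟩
  have hint' : Integrable (fun z : State n => z) μ := by
    refine (hint.add (integrable_const y)).congr (ae_of_all _ fun z => ?_)
    simp
  have hmean : ‖y - ∫ w, w ∂μ‖ₑ ≤ (∫⁻ z, ‖z - y‖ₑ ^ 2 ∂μ) ^ (1 / 2 : ℝ) := by
    refine le_trans ?_ hL1
    have := enorm_integral_le_lintegral_enorm (μ := μ) fun z : State n => z - y
    rw [integral_sub hint' (integrable_const y)] at this
    rw [← enorm_neg, neg_sub]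
    simpa using this
  calc totalVariance μ ^ (1 / 2 : ℝ)
      ≤ (∫⁻ z, (‖z - y‖ₑ + ‖y - ∫ w, w ∂μ‖ₑ) ^ 2 ∂μ) ^ (1 / 2 : ℝ) := by
        unfold totalVariance
        gcongr with z
        calc ‖z - ∫ w, w ∂μ‖ₑ = ‖(z - y) + (y - ∫ w, w ∂μ)‖ₑ := by congr 1; abel
          _ ≤ _ := enorm_add_le _ _
    _ ≤ _ := lintegral_sq_add_const_le (by fun_prop) _
    _ ≤ _ := by rw [two_mul]; gcongr

/-- Half the standard deviation of `T x` is a lower bound for `W2 (T x) δ_y` that is uniform in `y`.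
-/
lemma intrinsicSpread_pos (T : Kernel (State n) (State n)) [IsMarkovKernel T]
    (h : ∃ x, 0 < totalVariance (T x)) : 0 < intrinsicSpread T := by
  obtain ⟨x, hx⟩ := h
  have hpos : 0 < totalVariance (T x) ^ (1 / 2 : ℝ) / 2 :=
    ENNReal.div_pos (ENNReal.rpow_pos_of_nonneg hx (by norm_num)).ne' (by norm_num)
  refine hpos.trans_le (le_trans (le_iInf fun y => ?_)
    (le_iSup (fun x => ⨅ y, W2 (T x) (Measure.dirac y)) x))
  refine ENNReal.div_le_of_le_mul' ((totalVariance_rpow_half_le (T x) y).trans ?_)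
  gcongr
  exact W2_dirac _ _

/-! ### Completing subcoupling densities to couplings. -/

section Density

variable {E : Type*} [MeasurableSpace E]

/-- A subcoupling density `f` completed by a multiple of the product of the residual marginals. -/
noncomputable def completedDensity (f : E × E → ℝ≥0∞) (μ ν : Measure E) (p : E × E) : ℝ≥0∞ :=
  f p + (1 - ∫⁻ z, f (p.1, z) ∂ν) * (1 - ∫⁻ y, f (y, p.2) ∂μ) /
    ∫⁻ y, (1 - ∫⁻ z, f (y, z) ∂ν) ∂μ

lemma residual_ne_top {f : E × E → ℝ≥0∞} {μ ν : Measure E} [IsProbabilityMeasure μ] :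
    ∫⁻ y, (1 - ∫⁻ z, f (y, z) ∂ν) ∂μ ≠ ⊤ :=
  ne_top_of_le_ne_top (b := ∫⁻ _, 1 ∂μ) (by simp) (lintegral_mono fun _ => tsub_le_self)

lemma mul_mul_div_self_le {a m : ℝ≥0∞} : a * m / m ≤ a := by
  rw [mul_div_assoc]
  exact mul_le_of_le_one_right' ENNReal.div_self_le_one

lemma map_fst_withDensity_prod {μ ν : Measure E} [SFinite ν]
    {g : E × E → ℝ≥0∞} (hg : Measurable g)
    (h : ∀ᵐ y ∂μ, ∫⁻ z, g (y, z) ∂ν = 1) : ((μ.prod ν).withDensity g).map Prod.fst = μ := by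
  ext s hs
  rw [Measure.map_apply measurable_fst hs, withDensity_apply _ (measurable_fst hs),
    ← lintegral_indicator (measurable_fst hs), lintegral_prod _
    (hg.indicator (measurable_fst hs)).aemeasurable, ← lintegral_indicator_one hs]
  refine lintegral_congr_ae ?_
  filter_upwards [h] with y hy
  by_cases hys : y ∈ s
  · simp [Set.indicator, hys, hy]
  · simp [Set.indicator, hys]

lemma map_snd_withDensity_prod {μ ν : Measure E} [SFinite μ] [SFinite ν]
    {g : E × E → ℝ≥0∞} (hg : Measurable g)
    (h : ∀ᵐ z ∂ν, ∫⁻ y, g (y, z) ∂μ = 1) : ((μ.prod ν).withDensity g).map Prod.snd = ν := by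
  ext s hs
  rw [Measure.map_apply measurable_snd hs, withDensity_apply _ (measurable_snd hs),
    ← lintegral_indicator (measurable_snd hs), lintegral_prod_symm _
    (hg.indicator (measurable_snd hs)).aemeasurable, ← lintegral_indicator_one hs]
  refine lintegral_congr_ae ?_
  filter_upwards [h] with y hy
  by_cases hys : y ∈ s
  · simp [Set.indicator, hys, hy]
  · simp [Set.indicator, hys]

variable {f : E × E → ℝ≥0∞} {μ ν : Measure E} [IsProbabilityMeasure μ] [IsProbabilityMeasure ν]

lemma measurable_completedDensity (hf : Measurable f) : Measurable (completedDensity f μ ν) := by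
  have h1 : Measurable fun y => ∫⁻ z, f (y, z) ∂ν := hf.lintegral_prod_right'
  have h2 : Measurable fun z => ∫⁻ y, f (y, z) ∂μ := hf.lintegral_prod_left'
  unfold completedDensity
  fun_prop

/-- With its counterpart for the other marginal, this shows that both residuals have the same mass,
so one normalising constant serves both. -/
lemma lintegral_one_sub_fst (hf : Measurable f) (h1 : ∀ᵐ y ∂μ, ∫⁻ z, f (y, z) ∂ν ≤ 1) :
    ∫⁻ y, (1 - ∫⁻ z, f (y, z) ∂ν) ∂μ = 1 - ∫⁻ p, f p ∂(μ.prod ν) := by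
  have hm : Measurable fun y => ∫⁻ z, f (y, z) ∂ν := hf.lintegral_prod_right'
  rw [lintegral_sub hm _ h1, lintegral_prod _ hf.aemeasurable]
  · simp
  · refine ne_top_of_le_ne_top (b := ∫⁻ _, 1 ∂μ) (by simp) (lintegral_mono_ae h1)

lemma lintegral_one_sub_snd (hf : Measurable f) (h2 : ∀ᵐ z ∂ν, ∫⁻ y, f (y, z) ∂μ ≤ 1) :
    ∫⁻ z, (1 - ∫⁻ y, f (y, z) ∂μ) ∂ν = 1 - ∫⁻ p, f p ∂(μ.prod ν) := by
  have hm : Measurable fun z => ∫⁻ y, f (y, z) ∂μ := hf.lintegral_prod_left'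
  rw [lintegral_sub hm _ h2, lintegral_prod_symm _ hf.aemeasurable]
  · simp
  · refine ne_top_of_le_ne_top (b := ∫⁻ _, 1 ∂ν) (by simp) (lintegral_mono_ae h2)

lemma lintegral_completedDensity_fst (hf : Measurable f)
    (h1 : ∀ᵐ y ∂μ, ∫⁻ z, f (y, z) ∂ν ≤ 1) (h2 : ∀ᵐ z ∂ν, ∫⁻ y, f (y, z) ∂μ ≤ 1) :
    ∀ᵐ y ∂μ, ∫⁻ z, completedDensity f μ ν (y, z) ∂ν = 1 := by
  have hm : Measurable fun z => ∫⁻ y, f (y, z) ∂μ := hf.lintegral_prod_left'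
  have hm' : Measurable fun y => ∫⁻ z, f (y, z) ∂ν := hf.lintegral_prod_right'
  have key (y : E) : ∫⁻ z, completedDensity f μ ν (y, z) ∂ν = ∫⁻ z, f (y, z) ∂ν +
      (1 - ∫⁻ z, f (y, z) ∂ν) * (∫⁻ y, (1 - ∫⁻ z, f (y, z) ∂ν) ∂μ) /
        ∫⁻ y, (1 - ∫⁻ z, f (y, z) ∂ν) ∂μ := by
    unfold completedDensity
    rw [lintegral_add_left (by fun_prop)]
    congr 1
    simp only [div_eq_mul_inv]
    rw [lintegral_mul_const _ (by fun_prop), lintegral_const_mul _ (by fun_prop),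
      lintegral_one_sub_snd hf h2, lintegral_one_sub_fst hf h1]
  by_cases h0 : ∫⁻ y, (1 - ∫⁻ z, f (y, z) ∂ν) ∂μ = 0
  -- With no residual mass, almost every section of `f` already integrates to 1 and the correction
  -- has a zero factor.
  · have h0' := (lintegral_eq_zero_iff (by fun_prop)).1 h0
    filter_upwards [h1, h0'] with y hy hy'
    have : ∫⁻ z, f (y, z) ∂ν = 1 := le_antisymm hy (tsub_eq_zero_iff_le.1 hy')
    rw [key, this]; simp
  · filter_upwards [h1] with y hy
    rw [key, ENNReal.mul_div_cancel_right h0 residual_ne_top, add_tsub_cancel_of_le hy]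

lemma lintegral_completedDensity_snd (hf : Measurable f)
    (h1 : ∀ᵐ y ∂μ, ∫⁻ z, f (y, z) ∂ν ≤ 1) (h2 : ∀ᵐ z ∂ν, ∫⁻ y, f (y, z) ∂μ ≤ 1) :
    ∀ᵐ z ∂ν, ∫⁻ y, completedDensity f μ ν (y, z) ∂μ = 1 := by
  have h := lintegral_completedDensity_fst (f := f ∘ Prod.swap) (μ := ν) (ν := μ)
    (hf.comp measurable_swap) h2 h1
  filter_upwards [h] with z hz
  rw [← hz]
  refine lintegral_congr fun y => ?_
  have e : ∫⁻ y, (1 - ∫⁻ z, f (y, z) ∂ν) ∂μ = ∫⁻ z, (1 - ∫⁻ y, f (y, z) ∂μ) ∂ν := by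
    rw [lintegral_one_sub_snd hf h2, lintegral_one_sub_fst hf h1]
  simp only [completedDensity, Function.comp, Prod.swap_prod_mk]
  rw [e, mul_comm (1 - _)]

end Density

lemma completedDensity_mem_couplings {f : State n × State n → ℝ≥0∞} {μ ν : Measure (State n)}
    [IsProbabilityMeasure μ] [IsProbabilityMeasure ν] (hf : Measurable f)
    (h1 : ∀ᵐ y ∂μ, ∫⁻ z, f (y, z) ∂ν ≤ 1) (h2 : ∀ᵐ z ∂ν, ∫⁻ y, f (y, z) ∂μ ≤ 1) :
    (μ.prod ν).withDensity (completedDensity f μ ν) ∈ couplings μ ν :=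
  ⟨map_fst_withDensity_prod (measurable_completedDensity hf)
      (lintegral_completedDensity_fst hf h1 h2),
    map_snd_withDensity_prod (measurable_completedDensity hf)
      (lintegral_completedDensity_snd hf h1 h2)⟩

/-- The cost of a completed density: the residual part is controlled by second moments. -/
lemma lintegral_completedDensity_cost_le {f : State n × State n → ℝ≥0∞} {μ ν : Measure (State n)}
    [IsProbabilityMeasure μ] [IsProbabilityMeasure ν] (hf : Measurable f)
    (h1 : ∀ᵐ y ∂μ, ∫⁻ z, f (y, z) ∂ν ≤ 1) (h2 : ∀ᵐ z ∂ν, ∫⁻ y, f (y, z) ∂μ ≤ 1) :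
    ∫⁻ p, completedDensity f μ ν p * ‖p.1 - p.2‖ₑ ^ 2 ∂(μ.prod ν) ≤
      ∫⁻ p, f p * ‖p.1 - p.2‖ₑ ^ 2 ∂(μ.prod ν) +
        2 * (∫⁻ y, (1 - ∫⁻ z, f (y, z) ∂ν) * ‖y‖ₑ ^ 2 ∂μ +
          ∫⁻ z, (1 - ∫⁻ y, f (y, z) ∂μ) * ‖z‖ₑ ^ 2 ∂ν) := by
  have hma : Measurable fun y => ∫⁻ z, f (y, z) ∂ν := hf.lintegral_prod_right'
  have hmb : Measurable fun z => ∫⁻ y, f (y, z) ∂μ := hf.lintegral_prod_left'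
  set a : State n → ℝ≥0∞ := fun y => 1 - ∫⁻ z, f (y, z) ∂ν with ha
  set b : State n → ℝ≥0∞ := fun z => 1 - ∫⁻ y, f (y, z) ∂μ with hb
  have hma' : Measurable a := by fun_prop
  have hmb' : Measurable b := by fun_prop
  set m := ∫⁻ y, a y ∂μ with hm
  have hmb2 : ∫⁻ z, b z ∂ν = m := by
    rw [hb, hm, ha, lintegral_one_sub_snd hf h2, lintegral_one_sub_fst hf h1]
  have e (p : State n × State n) : completedDensity f μ ν p = f p + a p.1 * b p.2 / m := rfl
  calc ∫⁻ p, completedDensity f μ ν p * ‖p.1 - p.2‖ₑ ^ 2 ∂(μ.prod ν)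
      ≤ ∫⁻ p, (f p * ‖p.1 - p.2‖ₑ ^ 2 + 2 * ((a p.1 * ‖p.1‖ₑ ^ 2) * b p.2 * m⁻¹ +
          a p.1 * (b p.2 * ‖p.2‖ₑ ^ 2) * m⁻¹)) ∂(μ.prod ν) := by
        refine lintegral_mono fun p => ?_
        have hp : ‖p.1 - p.2‖ₑ ^ 2 ≤ 2 * (‖p.1‖ₑ ^ 2 + ‖p.2‖ₑ ^ 2) := by
          refine le_trans ?_ (add_sq_le _ _)
          gcongr
          exact enorm_sub_le
        rw [e, add_mul]
        refine add_le_add le_rfl ?_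
        calc a p.1 * b p.2 / m * ‖p.1 - p.2‖ₑ ^ 2
            ≤ a p.1 * b p.2 / m * (2 * (‖p.1‖ₑ ^ 2 + ‖p.2‖ₑ ^ 2)) := by gcongr
          _ = _ := by rw [div_eq_mul_inv]; ring
    -- In each product term the factor without the norm integrates to `m`, against the normalisation
    -- `m⁻¹`. Only `m * m⁻¹ ≤ 1` is needed, which also covers `m = 0`.
    _ = ∫⁻ p, f p * ‖p.1 - p.2‖ₑ ^ 2 ∂(μ.prod ν) +
        2 * ((∫⁻ y, a y * ‖y‖ₑ ^ 2 ∂μ) * m * m⁻¹ +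
          m * (∫⁻ z, b z * ‖z‖ₑ ^ 2 ∂ν) * m⁻¹) := by
        rw [lintegral_add_left (by fun_prop), lintegral_const_mul _ (by fun_prop),
          lintegral_add_left (by fun_prop), lintegral_mul_const _ (by fun_prop),
          lintegral_mul_const _ (by fun_prop),
          lintegral_prod_mul (f := fun y => a y * ‖y‖ₑ ^ 2) (g := b) (by fun_prop) (by fun_prop),
          lintegral_prod_mul (f := a) (g := fun y => b y * ‖y‖ₑ ^ 2) (by fun_prop) (by fun_prop),
          hmb2]
    _ ≤ _ := by
        gcongr
        · exact mul_mul_div_self_le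
        · rw [mul_comm m]; exact mul_mul_div_self_le

/-! ### Discretising couplings. -/

/-- A countable family of functions on `ℕ × ℕ`: finite suprema of point masses with values in a
fixed countable dense set. -/
noncomputable def stepFn (s : Finset (ℕ × ℕ × ℕ)) (p : ℕ × ℕ) : ℝ≥0∞ :=
  s.sup fun t => if t.2 = p then TopologicalSpace.denseSeq ℝ≥0∞ t.1 else 0

lemma exists_stepFn_approx (F : ℕ × ℕ → ℝ≥0∞) :
    ∃ s : ℕ → Finset (ℕ × ℕ × ℕ), (∀ p, Monotone fun N => stepFn (s N) p) ∧
      ∀ p, ⨆ N, stepFn (s N) p = F p := by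
  classical
  refine ⟨fun N => (Finset.range N ×ˢ Finset.range N ×ˢ Finset.range N).filter
    fun t => TopologicalSpace.denseSeq ℝ≥0∞ t.1 ≤ F t.2, fun p N M h => ?_, fun p => ?_⟩
  · refine Finset.sup_mono (Finset.filter_subset_filter _ ?_)
    have := Finset.range_mono h
    exact Finset.product_subset_product this (Finset.product_subset_product this this)
  · refine le_antisymm (iSup_le fun N => Finset.sup_le fun t ht => ?_)
      (le_of_forall_lt fun c hc => ?_)
    · split_ifs with h
      · rw [← h]; exact (Finset.mem_filter.1 ht).2
      · exact zero_le
    · obtain ⟨_, ⟨k, rfl⟩, hk1, hk2⟩ :=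
        (TopologicalSpace.denseRange_denseSeq ℝ≥0∞).exists_between hc
      -- Large enough for the triple `(k, p)` to lie in the `N`-th box.
      set N := max k (max p.1 p.2) + 1 with hN
      refine lt_of_lt_of_le hk1 (le_trans ?_ (le_iSup _ N))
      refine le_trans ?_ (Finset.le_sup (b := (k, p)) ?_)
      · simp
      · simp only [Finset.mem_filter, Finset.mem_product, Finset.mem_range]
        exact ⟨⟨by omega, by omega, by omega⟩, hk2.le⟩

/-- Partitions of a separable space into countably many measurable cells of small size. -/
lemma exists_measurable_grid (E : Type*) [NormedAddCommGroup E] [MeasurableSpace E] [BorelSpace E]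
    [SecondCountableTopology E] :
    ∃ (d : ℕ → E) (q : ℕ → E → ℕ), (∀ m, Measurable (q m)) ∧
      ∀ m x, ‖x - d (q m x)‖ₑ ≤ (m : ℝ≥0∞)⁻¹ := by
  classical
  have h (m : ℕ) (x : E) : ∃ k, ‖x - TopologicalSpace.denseSeq E k‖ₑ < (m : ℝ≥0∞)⁻¹ := by
    have hx : x ∈ closure (Set.range (TopologicalSpace.denseSeq E)) :=
      TopologicalSpace.denseRange_denseSeq E x
    obtain ⟨_, ⟨k, rfl⟩, hk⟩ := EMetric.mem_closure_iff.1 hx (m : ℝ≥0∞)⁻¹ (by simp)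
    exact ⟨k, by rwa [edist_eq_enorm_sub] at hk⟩
  refine ⟨TopologicalSpace.denseSeq E, fun m x => Nat.find (h m x), fun m => ?_,
    fun m x => (Nat.find_spec (h m x)).le⟩
  refine measurable_find _ fun k => measurableSet_lt ?_ measurable_const
  fun_prop

lemma ae_eq_one_of_mul_singleton {μ : Measure ℕ} [IsFiniteMeasure μ] {a : ℕ → ℝ≥0∞}
    (h : ∀ i, a i * μ {i} = μ {i}) : ∀ᵐ i ∂μ, a i = 1 := by
  rw [ae_iff_of_countable]
  intro i hi
  have := h i
  rwa [ENNReal.mul_eq_right hi (measure_ne_top _ _)] at this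

/-- A coupling seen through a countable partition has a density with respect to the product of its
marginals. -/
lemma exists_cell_density {μ ν : Measure (State n)} [IsProbabilityMeasure μ]
    [IsProbabilityMeasure ν] {π : Measure (State n × State n)} (hπ : π ∈ couplings μ ν)
    {q : State n → ℕ} (hq : Measurable q) :
    ∃ F : ℕ × ℕ → ℝ≥0∞,
      (∀ h : ℕ × ℕ → ℝ≥0∞, ∫⁻ p, F (q p.1, q p.2) * h (q p.1, q p.2) ∂(μ.prod ν) =
        ∫⁻ p, h (q p.1, q p.2) ∂π) ∧
      (∀ᵐ y ∂μ, ∫⁻ z, F (q y, q z) ∂ν = 1) ∧ (∀ᵐ z ∂ν, ∫⁻ y, F (q y, q z) ∂μ = 1) := by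
  have := isProbabilityMeasure_of_mem_couplings hπ
  have hq2 : Measurable (Prod.map q q) := hq.prodMap hq
  have := Measure.isProbabilityMeasure_map (μ := μ) hq.aemeasurable
  have := Measure.isProbabilityMeasure_map (μ := ν) hq.aemeasurable
  have := Measure.isProbabilityMeasure_map (μ := π) hq2.aemeasurable
  set ρ := π.map (Prod.map q q) with hρ
  set σ := (μ.map q).prod (ν.map q) with hσ
  have hσ' : σ = (μ.prod ν).map (Prod.map q q) := Measure.map_prod_map _ _ hq hq
  have hac : ρ ≪ σ := by
    refine Measure.AbsolutelyContinuous.mk fun s hs h0 => ?_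
    -- By countability, single points suffice. A `σ`-null point has a coordinate that is null for
    -- its marginal, and `ρ` has the same marginals.
    rw [← Set.biUnion_of_singleton s, measure_biUnion_null_iff s.to_countable]
    rintro ⟨i, j⟩ hij
    have h1 : σ {(i, j)} = 0 := measure_mono_null (Set.singleton_subset_iff.2 hij) h0
    rw [hσ, ← Set.singleton_prod_singleton, Measure.prod_prod, mul_eq_zero] at h1
    rw [hρ, Measure.map_apply hq2 (measurableSet_singleton _)]
    rcases h1 with h1 | h1
    · rw [Measure.map_apply hq (measurableSet_singleton _), ← hπ.1,
        Measure.map_apply measurable_fst (hq (measurableSet_singleton _))] at h1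
      refine measure_mono_null (fun z hz => ?_) h1
      exact congrArg Prod.fst hz
    · rw [Measure.map_apply hq (measurableSet_singleton _), ← hπ.2,
        Measure.map_apply measurable_snd (hq (measurableSet_singleton _))] at h1
      refine measure_mono_null (fun z hz => ?_) h1
      exact congrArg Prod.snd hz
  set F := ρ.rnDeriv σ with hF
  have hh (h : ℕ × ℕ → ℝ≥0∞) : ∫⁻ p, F (q p.1, q p.2) * h (q p.1, q p.2) ∂(μ.prod ν) =
        ∫⁻ p, h (q p.1, q p.2) ∂π := by
    have e1 : ∫⁻ p, F p * h p ∂σ = ∫⁻ p, h p ∂ρ := by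
      conv_rhs => rw [← Measure.withDensity_rnDeriv_eq ρ σ hac]
      rw [lintegral_withDensity_eq_lintegral_mul _ (Measure.measurable_rnDeriv _ _)
        (measurable_of_countable h)]
      rfl
    rw [hσ', hρ, lintegral_map (measurable_of_countable _) hq2,
      lintegral_map (measurable_of_countable _) hq2] at e1
    exact e1
  refine ⟨F, hh, ?_, ?_⟩
  · refine ae_of_ae_map (p := fun i => ∫⁻ z, F (i, q z) ∂ν = 1) hq.aemeasurable
      (ae_eq_one_of_mul_singleton fun i => ?_)
    -- Testing on the row `i` gives the row integral times the mass of cell `i` equal to that mass,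
    -- and positive atoms can be cancelled.
    have h1 := hh (Set.indicator {p | p.1 = i} 1)
    have h2 : ∫⁻ p, Set.indicator {p | p.1 = i} (1 : ℕ × ℕ → ℝ≥0∞) (q p.1, q p.2) ∂π =
        μ.map q {i} := by
      rw [Measure.map_apply hq (measurableSet_singleton _), ← hπ.1,
        Measure.map_apply measurable_fst (hq (measurableSet_singleton _)),
        ← lintegral_indicator_one (measurable_fst (hq (measurableSet_singleton _)))]
      rfl
    have h3 := lintegral_prod (μ := μ) (ν := ν) _ ((measurable_of_countable fun j : ℕ × ℕ =>
      F j * Set.indicator {p | p.1 = i} 1 j).comp hq2).aemeasurable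
    rw [h2] at h1
    replace h1 := h3.symm.trans h1
    simp only [Function.comp, Prod.map] at h1
    refine Eq.trans ?_ h1
    rw [← lintegral_indicator_one (measurableSet_singleton i), ← lintegral_const_mul _
      (measurable_of_countable _), lintegral_map (measurable_of_countable _) hq]
    refine lintegral_congr fun y => ?_
    by_cases hy : q y = i
    · simp [Set.indicator, hy]
    · simp [Set.indicator, hy]
  · refine ae_of_ae_map (p := fun i => ∫⁻ y, F (q y, i) ∂μ = 1) hq.aemeasurable
      (ae_eq_one_of_mul_singleton fun i => ?_)
    have h1 := hh (Set.indicator {p | p.2 = i} 1)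
    have h2 : ∫⁻ p, Set.indicator {p | p.2 = i} (1 : ℕ × ℕ → ℝ≥0∞) (q p.1, q p.2) ∂π =
        ν.map q {i} := by
      rw [Measure.map_apply hq (measurableSet_singleton _), ← hπ.2,
        Measure.map_apply measurable_snd (hq (measurableSet_singleton _)),
        ← lintegral_indicator_one (measurable_snd (hq (measurableSet_singleton _)))]
      rfl
    have h3 := lintegral_prod_symm (μ := μ) (ν := ν) _ ((measurable_of_countable fun j : ℕ × ℕ =>
      F j * Set.indicator {p | p.2 = i} 1 j).comp hq2).aemeasurable
    rw [h2] at h1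
    replace h1 := h3.symm.trans h1
    simp only [Function.comp, Prod.map] at h1
    refine Eq.trans ?_ h1
    rw [← lintegral_indicator_one (measurableSet_singleton i), ← lintegral_const_mul _
      (measurable_of_countable _), lintegral_map (measurable_of_countable _) hq]
    refine lintegral_congr fun y => ?_
    by_cases hy : q y = i
    · simp [Set.indicator, hy]
    · simp [Set.indicator, hy]

/-- Smearing a coupling over cells of size `δ` increases the `L²` cost by at most `4 δ`. -/
lemma lintegral_cell_density_cost_le {μ ν : Measure (State n)} [IsProbabilityMeasure μ]
    [IsProbabilityMeasure ν] {π : Measure (State n × State n)} [IsProbabilityMeasure π]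
    {q : State n → ℕ} {d : ℕ → State n} {δ : ℝ≥0∞} (hd : ∀ x, ‖x - d (q x)‖ₑ ≤ δ)
    {F : ℕ × ℕ → ℝ≥0∞}
    (hF : ∀ h : ℕ × ℕ → ℝ≥0∞, ∫⁻ p, F (q p.1, q p.2) * h (q p.1, q p.2) ∂(μ.prod ν) =
        ∫⁻ p, h (q p.1, q p.2) ∂π) :
    (∫⁻ p, F (q p.1, q p.2) * ‖p.1 - p.2‖ₑ ^ 2 ∂(μ.prod ν)) ^ (1 / 2 : ℝ) ≤
      (∫⁻ p, ‖p.1 - p.2‖ₑ ^ 2 ∂π) ^ (1 / 2 : ℝ) + 4 * δ := by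
  have hd' (x : State n) : ‖d (q x) - x‖ₑ ≤ δ := by rw [← enorm_neg, neg_sub]; exact hd x
  have t1 (x y : State n) : ‖x - y‖ₑ ≤ ‖d (q x) - d (q y)‖ₑ + 2 * δ :=
    calc ‖x - y‖ₑ = ‖(d (q x) - d (q y)) + ((x - d (q x)) + (d (q y) - y))‖ₑ := by
          congr 1; abel
      _ ≤ _ := (enorm_add_le _ _).trans (add_le_add le_rfl (enorm_add_le _ _))
      _ ≤ _ := by rw [two_mul]; gcongr; exacts [hd x, hd' y]
  have t2 (x y : State n) : ‖d (q x) - d (q y)‖ₑ ≤ ‖x - y‖ₑ + 2 * δ :=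
    calc ‖d (q x) - d (q y)‖ₑ = ‖(x - y) + ((d (q x) - x) + (y - d (q y)))‖ₑ := by
          congr 1; abel
      _ ≤ _ := (enorm_add_le _ _).trans (add_le_add le_rfl (enorm_add_le _ _))
      _ ≤ _ := by rw [two_mul]; gcongr; exacts [hd' x, hd y]
  -- The density and `π` agree only on functions of the cells: pass to cell centres, exchange the
  -- measures, and pass back, losing `2 * δ` each way.
  calc (∫⁻ p, F (q p.1, q p.2) * ‖p.1 - p.2‖ₑ ^ 2 ∂(μ.prod ν)) ^ (1 / 2 : ℝ)
      ≤ (∫⁻ p, F (q p.1, q p.2) * (‖d (q p.1) - d (q p.2)‖ₑ + 2 * δ) ^ 2 ∂(μ.prod ν))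
          ^ (1 / 2 : ℝ) := by gcongr with p; exact t1 _ _
    _ = (∫⁻ p, (‖d (q p.1) - d (q p.2)‖ₑ + 2 * δ) ^ 2 ∂π) ^ (1 / 2 : ℝ) := by
        rw [hF fun i => (‖d i.1 - d i.2‖ₑ + 2 * δ) ^ 2]
    _ ≤ (∫⁻ p, (‖p.1 - p.2‖ₑ + 4 * δ) ^ 2 ∂π) ^ (1 / 2 : ℝ) := by
        refine ENNReal.rpow_le_rpow (lintegral_mono fun p => pow_le_pow_left' ?_ 2) (by norm_num)
        calc _ ≤ ‖p.1 - p.2‖ₑ + 2 * δ + 2 * δ := add_le_add (t2 _ _) le_rfl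
          _ = _ := by ring
    _ ≤ _ := lintegral_sq_add_const_le (by fun_prop) _

/-! ### Measurable selection of couplings. -/

/-- Dominated convergence with dominating function `w`; applied with `w = ‖·‖²`, it makes the
residual cost negligible. -/
lemma tendsto_lintegral_residual {α : Type*} [MeasurableSpace α] {μ : Measure α}
    {a : ℕ → α → ℝ≥0∞} {w : α → ℝ≥0∞} (ha : ∀ N, Measurable (a N)) (hw : Measurable w)
    (hw' : ∫⁻ x, w x ∂μ ≠ ⊤)
    (h : ∀ᵐ x ∂μ, Filter.Tendsto (fun N => a N x) Filter.atTop (nhds 1)) :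
    Filter.Tendsto (fun N => ∫⁻ x, (1 - a N x) * w x ∂μ) Filter.atTop (nhds 0) := by
  have hlt := ae_lt_top hw hw'
  have := tendsto_lintegral_of_dominated_convergence (μ := μ) (F := fun N x => (1 - a N x) * w x)
    (f := fun _ => 0) w (fun N => by have := ha N; fun_prop)
    (fun N => ae_of_all _ fun x => mul_le_of_le_one_left' tsub_le_self) hw' ?_
  · simpa using this
  · filter_upwards [h, hlt] with x hx hxw
    have h1 := ENNReal.Tendsto.sub (tendsto_const_nhds (x := (1 : ℝ≥0∞))) hx (by simp)
    have h2 := ENNReal.Tendsto.mul_const (b := w x) h1 (Or.inr hxw.ne)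
    simpa using h2

/-- There is one sequence of densities such that, for any two laws with finite second moments,
the completions of its members have costs arbitrarily close to the optimal one. -/
lemma exists_density_seq (n : ℕ) :
    ∃ f : ℕ → State n × State n → ℝ≥0∞, (∀ k, Measurable (f k)) ∧
      ∀ (μ ν : Measure (State n)) [IsProbabilityMeasure μ] [IsProbabilityMeasure ν],
        ∫⁻ z, ‖z‖ₑ ^ 2 ∂μ ≠ ⊤ → ∫⁻ z, ‖z‖ₑ ^ 2 ∂ν ≠ ⊤ → ∀ c, W2 μ ν ^ 2 < c →
        ∃ k, (∀ᵐ y ∂μ, ∫⁻ z, f k (y, z) ∂ν ≤ 1) ∧ (∀ᵐ z ∂ν, ∫⁻ y, f k (y, z) ∂μ ≤ 1) ∧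
          ∫⁻ p, completedDensity (f k) μ ν p * ‖p.1 - p.2‖ₑ ^ 2 ∂(μ.prod ν) < c := by
  obtain ⟨d, q, hq, hd⟩ := exists_measurable_grid (State n)
  -- A single index encodes the mesh `m` and the finite data of a step function, independently of
  -- the two laws.
  obtain ⟨e, he⟩ := exists_surjective_nat (ℕ × Finset (ℕ × ℕ × ℕ))
  have hmeas (m : ℕ) (G : ℕ × ℕ → ℝ≥0∞) :
      Measurable fun p : State n × State n => G (q m p.1, q m p.2) :=
    (measurable_of_countable G).comp ((hq m).prodMap (hq m))
  refine ⟨fun k p => stepFn (e k).2 (q (e k).1 p.1, q (e k).1 p.2), fun k => hmeas _ _, ?_⟩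
  intro μ ν _ _ hμ hν c hc
  obtain ⟨π, hπ, hπc⟩ := exists_coupling_of_W2_sq_lt hc
  have := isProbabilityMeasure_of_mem_couplings hπ
  have hπc' := ENNReal.rpow_lt_rpow hπc (z := 1 / 2) (by norm_num)
  obtain ⟨η, hη, hlt⟩ := ENNReal.lt_iff_exists_add_pos_lt.1 hπc'
  -- The smearing loss `4 / m` must fit into the slack `η` left by `π`.
  obtain ⟨m, hm⟩ := ENNReal.exists_inv_nat_lt (a := (η / 4 : ℝ≥0∞)) (by simp [hη.ne'])
  obtain ⟨F, hF, hF1, hF2⟩ := exists_cell_density hπ (hq m)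
  have hcost : ∫⁻ p, F (q m p.1, q m p.2) * ‖p.1 - p.2‖ₑ ^ 2 ∂(μ.prod ν) < c := by
    rw [← ENNReal.rpow_lt_rpow_iff (z := 1 / 2) (by norm_num)]
    refine (lintegral_cell_density_cost_le (hd m) hF).trans_lt (lt_of_le_of_lt ?_ hlt)
    gcongr
    calc 4 * (m : ℝ≥0∞)⁻¹ ≤ 4 * (η / 4) := by gcongr
      _ = η := ENNReal.mul_div_cancel (by norm_num) (by norm_num)
  obtain ⟨s, hs, hs'⟩ := exists_stepFn_approx F
  have hle (N : ℕ) (p : ℕ × ℕ) : stepFn (s N) p ≤ F p :=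
    (hs' p) ▸ le_iSup (fun N => stepFn (s N) p) N
  have hsec1 (G : ℕ × ℕ → ℝ≥0∞) (y : State n) : Measurable fun z => G (q m y, q m z) :=
    (hmeas m G).comp measurable_prodMk_left
  have hsec2 (G : ℕ × ℕ → ℝ≥0∞) (z : State n) : Measurable fun y => G (q m y, q m z) :=
    (hmeas m G).comp measurable_prodMk_right
  have ha1 (N : ℕ) : ∀ᵐ y ∂μ, ∫⁻ z, stepFn (s N) (q m y, q m z) ∂ν ≤ 1 := by
    filter_upwards [hF1] with y hy
    exact hy ▸ lintegral_mono fun z => hle _ _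
  have hb1 (N : ℕ) : ∀ᵐ z ∂ν, ∫⁻ y, stepFn (s N) (q m y, q m z) ∂μ ≤ 1 := by
    filter_upwards [hF2] with y hy
    exact hy ▸ lintegral_mono fun z => hle _ _
  have hat : ∀ᵐ y ∂μ, Filter.Tendsto (fun N => ∫⁻ z, stepFn (s N) (q m y, q m z) ∂ν)
      Filter.atTop (nhds 1) := by
    filter_upwards [hF1] with y hy
    have : ⨆ N, ∫⁻ z, stepFn (s N) (q m y, q m z) ∂ν = 1 := by
      rw [← lintegral_iSup (fun N => hsec1 _ _) fun N M h z => hs _ h]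
      simp only [hs', hy]
    rw [← this]
    exact tendsto_atTop_iSup fun N M h => lintegral_mono fun z => hs _ h
  have hbt : ∀ᵐ z ∂ν, Filter.Tendsto (fun N => ∫⁻ y, stepFn (s N) (q m y, q m z) ∂μ)
      Filter.atTop (nhds 1) := by
    filter_upwards [hF2] with z hz
    have : ⨆ N, ∫⁻ y, stepFn (s N) (q m y, q m z) ∂μ = 1 := by
      rw [← lintegral_iSup (fun N => hsec2 _ _) fun N M h z => hs _ h]
      simp only [hs', hz]
    rw [← this]
    exact tendsto_atTop_iSup fun N M h => lintegral_mono fun z => hs _ h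
  have r1 := tendsto_lintegral_residual (fun N => (hmeas m (stepFn (s N))).lintegral_prod_right'
    (ν := ν)) (by fun_prop) hμ hat
  have r2 := tendsto_lintegral_residual (fun N => (hmeas m (stepFn (s N))).lintegral_prod_left'
    (μ := μ)) (by fun_prop) hν hbt
  have r3 := (tendsto_const_nhds
    (x := ∫⁻ p, F (q m p.1, q m p.2) * ‖p.1 - p.2‖ₑ ^ 2 ∂(μ.prod ν))).add
    (ENNReal.Tendsto.const_mul (a := 2) (r1.add r2) (Or.inr (by norm_num)))
  rw [add_zero, mul_zero, add_zero] at r3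
  obtain ⟨N, hN⟩ := (r3.eventually_lt_const hcost).exists
  obtain ⟨k, hk⟩ := he (m, s N)
  refine ⟨k, ?_⟩
  simp only [hk]
  refine ⟨ha1 N, hb1 N, ?_⟩
  refine (lintegral_completedDensity_cost_le (hmeas m _) (ha1 N) (hb1 N)).trans_lt
    (lt_of_le_of_lt ?_ hN)
  gcongr
  exact hle _ _

/-- Measurable selection of nearly optimal couplings. -/
lemma exists_coupling_kernel {X : Type*} [MeasurableSpace X] (κ η : Kernel X (State n))
    [IsMarkovKernel κ] [IsMarkovKernel η] (hκ : ∀ x, ∫⁻ z, ‖z‖ₑ ^ 2 ∂(κ x) ≠ ⊤)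
    (hη : ∀ x, ∫⁻ z, ‖z‖ₑ ^ 2 ∂(η x) ≠ ⊤) {c : X → ℝ≥0∞} (hc : Measurable c)
    (h : ∀ x, W2 (κ x) (η x) ^ 2 < c x) :
    ∃ Γ : Kernel X (State n × State n), ∀ x, Γ x ∈ couplings (κ x) (η x) ∧
      ∫⁻ z, ‖z.1 - z.2‖ₑ ^ 2 ∂(Γ x) < c x := by
  classical
  obtain ⟨f, hf, hsel⟩ := exists_density_seq n
  have ma (k : ℕ) : Measurable fun p : X × State n => ∫⁻ z, f k (p.2, z) ∂(η p.1) :=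
    Measurable.lintegral_kernel_prod_right' (κ := η.comap Prod.fst measurable_fst)
      (f := fun p : (X × State n) × State n => f k (p.1.2, p.2)) (by have := hf k; fun_prop)
  have mb (k : ℕ) : Measurable fun p : X × State n => ∫⁻ y, f k (y, p.2) ∂(κ p.1) :=
    Measurable.lintegral_kernel_prod_right' (κ := κ.comap Prod.fst measurable_fst)
      (f := fun p : (X × State n) × State n => f k (p.2, p.1.2)) (by have := hf k; fun_prop)
  have mm (k : ℕ) : Measurable fun x => ∫⁻ y, (1 - ∫⁻ z, f k (y, z) ∂(η x)) ∂(κ x) :=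
    Measurable.lintegral_kernel_prod_right' (κ := κ)
      (f := fun p => 1 - ∫⁻ z, f k (p.2, z) ∂(η p.1)) (by have := ma k; fun_prop)
  have mg (k : ℕ) : Measurable (Function.uncurry fun x p =>
      completedDensity (f k) (κ x) (η x) p) := by
    have h1 : Measurable fun w : X × State n × State n => f k w.2 := (hf k).comp measurable_snd
    have h2 : Measurable fun w : X × State n × State n => ∫⁻ z, f k (w.2.1, z) ∂(η w.1) :=
      (ma k).comp (g := fun p : X × State n => ∫⁻ z, f k (p.2, z) ∂(η p.1))
        (f := fun w : X × State n × State n => (w.1, w.2.1)) (by fun_prop)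
    have h3 : Measurable fun w : X × State n × State n => ∫⁻ y, f k (y, w.2.2) ∂(κ w.1) :=
      (mb k).comp (g := fun p : X × State n => ∫⁻ y, f k (y, p.2) ∂(κ p.1))
        (f := fun w : X × State n × State n => (w.1, w.2.2)) (by fun_prop)
    have h4 : Measurable fun w : X × State n × State n =>
        ∫⁻ y, (1 - ∫⁻ z, f k (y, z) ∂(η w.1)) ∂(κ w.1) := (mm k).comp measurable_fst
    exact h1.add (((h2.const_sub 1).mul (h3.const_sub 1)).div h4)
  set K : ℕ → Kernel X (State n × State n) := fun k =>
    (κ ×ₖ η).withDensity fun x p => completedDensity (f k) (κ x) (η x) p with hK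
  have hKx (k : ℕ) (x : X) : K k x =
      ((κ x).prod (η x)).withDensity (completedDensity (f k) (κ x) (η x)) := by
    rw [hK]
    simp only
    rw [Kernel.withDensity_apply _ (mg k), Kernel.prod_apply]
  -- The almost-everywhere bounds on the sections are written as vanishing integrals of the
  -- truncated excess, which are measurable in `x`.
  set good : ℕ → X → Prop := fun k x =>
    (∫⁻ y, (∫⁻ z, f k (y, z) ∂(η x)) - 1 ∂(κ x) = 0 ∧
      ∫⁻ z, (∫⁻ y, f k (y, z) ∂(κ x)) - 1 ∂(η x) = 0) ∧
      ∫⁻ z, ‖z.1 - z.2‖ₑ ^ 2 ∂(K k x) < c x with hgood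
  have hsecA (k : ℕ) (x : X) : Measurable fun y => ∫⁻ z, f k (y, z) ∂(η x) :=
    (hf k).lintegral_prod_right'
  have hsecB (k : ℕ) (x : X) : Measurable fun z => ∫⁻ y, f k (y, z) ∂(κ x) :=
    (hf k).lintegral_prod_left'
  have hgoodA (k : ℕ) (x : X) : ∫⁻ y, (∫⁻ z, f k (y, z) ∂(η x)) - 1 ∂(κ x) = 0 ↔
      ∀ᵐ y ∂(κ x), ∫⁻ z, f k (y, z) ∂(η x) ≤ 1 := by
    rw [lintegral_eq_zero_iff ((hsecA k x).sub_const 1)]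
    exact Filter.eventually_congr (ae_of_all _ fun y => tsub_eq_zero_iff_le)
  have hgoodB (k : ℕ) (x : X) : ∫⁻ z, (∫⁻ y, f k (y, z) ∂(κ x)) - 1 ∂(η x) = 0 ↔
      ∀ᵐ z ∂(η x), ∫⁻ y, f k (y, z) ∂(κ x) ≤ 1 := by
    rw [lintegral_eq_zero_iff ((hsecB k x).sub_const 1)]
    exact Filter.eventually_congr (ae_of_all _ fun y => tsub_eq_zero_iff_le)
  have hgoodm (k : ℕ) : MeasurableSet {x | good k x} := by
    have m1 : Measurable fun x => ∫⁻ y, (∫⁻ z, f k (y, z) ∂(η x)) - 1 ∂(κ x) :=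
      Measurable.lintegral_kernel_prod_right' (κ := κ)
        (f := fun p => (∫⁻ z, f k (p.2, z) ∂(η p.1)) - 1) ((ma k).sub_const 1)
    have m2 : Measurable fun x => ∫⁻ z, (∫⁻ y, f k (y, z) ∂(κ x)) - 1 ∂(η x) :=
      Measurable.lintegral_kernel_prod_right' (κ := η)
        (f := fun p => (∫⁻ y, f k (y, p.2) ∂(κ p.1)) - 1) ((mb k).sub_const 1)
    have m3 : Measurable fun x => ∫⁻ z, ‖z.1 - z.2‖ₑ ^ 2 ∂(K k x) :=
      (Measure.measurable_lintegral measurable_cost).comp (K k).measurable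
    exact ((m1 (measurableSet_singleton 0)).inter (m2 (measurableSet_singleton 0))).inter
      (measurableSet_lt m3 hc)
  have hex (x : X) : ∃ k, good k x := by
    obtain ⟨k, h1, h2, h3⟩ := hsel (κ x) (η x) (hκ x) (hη x) (c x) (h x)
    refine ⟨k, ⟨(hgoodA k x).2 h1, (hgoodB k x).2 h2⟩, ?_⟩
    rw [hKx, lintegral_withDensity_eq_lintegral_mul _ (measurable_completedDensity (hf k))
      measurable_cost]
    exact h3
  -- The least good index selects the candidate; countability makes the selection measurable.
  refine ⟨⟨fun x => K (Nat.find (hex x)) x,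
    Measurable.find (f := fun k x => K k x) (fun k => (K k).measurable) hgoodm hex⟩, fun x => ?_⟩
  obtain ⟨⟨h1, h2⟩, h3⟩ := Nat.find_spec (hex x)
  refine ⟨?_, h3⟩
  change K (Nat.find (hex x)) x ∈ _
  rw [hKx]
  exact completedDensity_mem_couplings (hf _) ((hgoodA _ x).1 h1) ((hgoodB _ x).1 h2)

/-! ### The error recursion. -/

/-- One step of the error recursion. -/
lemma W2_bind_le (T p : Kernel (State n) (State n)) [IsMarkovKernel T] [IsMarkovKernel p]
    (hp : ∀ x, ∫⁻ z, ‖z‖ₑ ^ 2 ∂(p x) ≠ ⊤) {ε L : ℝ≥0∞} (hε : ε ≠ ⊤) (hL : L ≠ ⊤) (hL0 : L ≠ 0)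
    (hT : ∀ x, W2 (T x) (p x) ≤ ε) (hLip : ∀ x y, W2 (p x) (p y) ≤ L * ‖x - y‖ₑ)
    (μ ν : Measure (State n)) [IsProbabilityMeasure μ] [IsProbabilityMeasure ν] :
    W2 (μ.bind T) (ν.bind p) ≤ ε + L * W2 μ ν := by
  have hT2 (x : State n) : ∫⁻ z, ‖z‖ₑ ^ 2 ∂(T x) ≠ ⊤ :=
    lintegral_sq_ne_top_of_W2 (ne_top_of_le_ne_top hε (hT x)) (hp x)
  have hstep (π : Measure (State n × State n)) (hπ : π ∈ couplings μ ν) :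
      W2 (μ.bind T) (ν.bind p) ≤ ε + L * (∫⁻ z, ‖z.1 - z.2‖ₑ ^ 2 ∂π) ^ (1 / 2 : ℝ) := by
    have := isProbabilityMeasure_of_mem_couplings hπ
    have hsq : W2 (μ.bind T) (ν.bind p) ^ 2 ≤ ∫⁻ z, (L * ‖z.1 - z.2‖ₑ + ε) ^ 2 ∂π := by
      -- The slack `δ` gives the strict inequality required to select nearly optimal couplings.
      refine ENNReal.le_of_forall_pos_le_add fun δ hδ _ => ?_
      obtain ⟨Γ, hΓ⟩ := exists_coupling_kernel
        (T.comap (Prod.fst : State n × State n → State n) measurable_fst)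
        (p.comap (Prod.snd : State n × State n → State n) measurable_snd)
        (fun z => hT2 z.1) (fun z => hp z.2)
        (c := fun z => (L * ‖z.1 - z.2‖ₑ + ε) ^ 2 + δ) (by fun_prop) (fun z => by
          have h1 : W2 (T z.1) (p z.2) ≤ L * ‖z.1 - z.2‖ₑ + ε := by
            rw [add_comm]
            exact (W2_triangle _ (p z.1) _).trans (add_le_add (hT _) (hLip _ _))
          refine lt_of_le_of_lt (b := (L * ‖z.1 - z.2‖ₑ + ε) ^ 2) (pow_le_pow_left' h1 2)
            (ENNReal.lt_add_right ?_ (by simpa using hδ.ne'))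
          exact ENNReal.pow_ne_top (ENNReal.add_ne_top.2 ⟨ENNReal.mul_ne_top hL (by simp), hε⟩))
      have hmem : π.bind Γ ∈ couplings (μ.bind T) (ν.bind p) := by
        constructor
        · ext s hs
          rw [Measure.map_apply measurable_fst hs, Measure.bind_apply (measurable_fst hs)
            Γ.aemeasurable, Measure.bind_apply hs T.aemeasurable, ← hπ.1,
            lintegral_map (T.measurable_coe hs) measurable_fst]
          refine lintegral_congr fun z => ?_
          rw [← Measure.map_apply measurable_fst hs, (hΓ z).1.1]
          rfl
        · ext s hs
          rw [Measure.map_apply measurable_snd hs, Measure.bind_apply (measurable_snd hs)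
            Γ.aemeasurable, Measure.bind_apply hs p.aemeasurable, ← hπ.2,
            lintegral_map (p.measurable_coe hs) measurable_snd]
          refine lintegral_congr fun z => ?_
          rw [← Measure.map_apply measurable_snd hs, (hΓ z).1.2]
          rfl
      rw [W2_sq]
      refine (iInf₂_le _ hmem).trans ?_
      rw [Measure.lintegral_bind Γ.aemeasurable measurable_cost.aemeasurable]
      refine (lintegral_mono fun z => (hΓ z).2.le).trans ?_
      rw [lintegral_add_right _ measurable_const, lintegral_const, measure_univ, mul_one]
    have h1 := ENNReal.rpow_le_rpow hsq (z := 1 / 2) (by norm_num)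
    rw [sq_rpow_half] at h1
    refine h1.trans ((lintegral_sq_add_const_le (by fun_prop) _).trans_eq ?_)
    simp only [mul_pow]
    rw [lintegral_const_mul _ (by fun_prop), ENNReal.mul_rpow_of_nonneg _ _ (by norm_num),
      sq_rpow_half, add_comm]
  -- Inverting the affine bound isolates the cost of `π`, so that the infimum over couplings can be
  -- taken.
  have h2 : ((W2 (μ.bind T) (ν.bind p) - ε) / L) ^ 2 ≤ W2 μ ν ^ 2 := by
    rw [W2_sq μ ν]
    refine le_iInf₂ fun π hπ => ?_
    rw [← rpow_half_sq (∫⁻ z, ‖z.1 - z.2‖ₑ ^ 2 ∂π)]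
    refine pow_le_pow_left' (ENNReal.div_le_of_le_mul' (tsub_le_iff_left.2 (hstep π hπ))) 2
  have h3 := (ENNReal.pow_le_pow_left_iff two_ne_zero).1 h2
  rw [ENNReal.div_le_iff hL0 hL, mul_comm] at h3
  exact tsub_le_iff_left.1 h3

lemma isProbabilityMeasure_marginal (T : Kernel (State n) (State n)) [IsMarkovKernel T]
    (μ₀ : Measure (State n)) [IsProbabilityMeasure μ₀] (t : ℕ) :
    IsProbabilityMeasure (marginal T μ₀ t) := by
  induction t with
  | zero => assumption
  | succ t ih => unfold marginal; infer_instance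

/-- The error bound, for a kernel with Wasserstein-Lipschitz constant at most `L`. -/
lemma W2_marginal_le (T p : Kernel (State n) (State n)) [IsMarkovKernel T] [IsMarkovKernel p]
    (μ₀ : Measure (State n)) [IsProbabilityMeasure μ₀] (hp : ∀ x, ∫⁻ z, ‖z‖ₑ ^ 2 ∂(p x) ≠ ⊤)
    {L : ℝ} (hL : 1 < L) (hLip : ∀ x y, W2 (p x) (p y) ≤ ENNReal.ofReal L * ‖x - y‖ₑ) (t : ℕ) :
    W2 (marginal T μ₀ t) (marginal p μ₀ t) ≤
      ENNReal.ofReal ((L ^ t - 1) / (L - 1)) * errProb T p := by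
  -- At step 0 the laws coincide; later the coefficient is positive and the right side is `⊤`.
  by_cases hε : errProb T p = ⊤
  · cases t with
    | zero => exact (W2_self μ₀).trans_le zero_le
    | succ t =>
      have : 0 < (L ^ (t + 1) - 1) / (L - 1) :=
        div_pos (sub_pos.2 (one_lt_pow₀ hL (by omega))) (sub_pos.2 hL)
      rw [hε, ENNReal.mul_top (by simpa using this)]
      exact le_top
  induction t with
  | zero => exact (W2_self μ₀).trans_le zero_le
  | succ t ih =>
    have := isProbabilityMeasure_marginal T μ₀ t
    have := isProbabilityMeasure_marginal p μ₀ t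
    have h0 : 0 ≤ (L ^ t - 1) / (L - 1) :=
      div_nonneg (sub_nonneg.2 (one_le_pow₀ hL.le)) (sub_pos.2 hL).le
    refine (W2_bind_le T p hp hε ENNReal.ofReal_ne_top (by simp; linarith)
      (fun x => le_iSup (fun x => W2 (T x) (p x)) x) hLip _ _).trans ?_
    calc errProb T p + ENNReal.ofReal L * W2 (marginal T μ₀ t) (marginal p μ₀ t)
        ≤ errProb T p +
          ENNReal.ofReal L * (ENNReal.ofReal ((L ^ t - 1) / (L - 1)) * errProb T p) := by gcongr
      _ = ENNReal.ofReal (1 + L * ((L ^ t - 1) / (L - 1))) * errProb T p := by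
        rw [ENNReal.ofReal_add zero_le_one (by positivity), ENNReal.ofReal_mul (by linarith),
          ENNReal.ofReal_one]
        ring
      _ = _ := by
        congr 2
        have : L - 1 ≠ 0 := (sub_pos.2 hL).ne'
        field_simp
        ring

/-! ### Exponential form and the two kinds of surrogate. -/

/-- Since `exp (Λ T) = L ^ t` and `Δt` cancels, this is `log L ≤ L - 1`. -/
lemma ofReal_geom_mul_le {L Δt : ℝ} (hL : 1 < L) (hΔt : 0 < Δt) (t : ℕ) (ε : ℝ≥0∞) :
    ENNReal.ofReal ((L ^ t - 1) / (L - 1)) * ε ≤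
      ENNReal.ofReal ((Real.exp (growthRate L Δt * (t * Δt)) - 1) / growthRate L Δt) *
        (ε / ENNReal.ofReal Δt) := by
  have hlog : 0 < Real.log L := Real.log_pos hL
  have hexp : Real.exp (growthRate L Δt * (t * Δt)) = L ^ t := by
    have : growthRate L Δt * (t * Δt) = t * Real.log L := by
      unfold growthRate; field_simp
    rw [this, Real.exp_nat_mul, Real.exp_log (by linarith)]
  have h1 : 0 ≤ L ^ t - 1 := sub_nonneg.2 (one_le_pow₀ hL.le)
  have h2 : (L ^ t - 1) / growthRate L Δt = (L ^ t - 1) / Real.log L * Δt := by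
    unfold growthRate; field_simp
  rw [hexp, h2, ENNReal.ofReal_mul (by positivity), mul_assoc, ENNReal.mul_div_cancel
    (by simpa using hΔt) ENNReal.ofReal_ne_top]
  gcongr
  have := Real.log_le_sub_one_of_pos (x := L) (by linarith)
  exact this

lemma W2_le_lipProb_mul {p : Kernel (State n) (State n)} {L : ℝ}
    (h : lipProb p = ENNReal.ofReal L) (x y : State n) :
    W2 (p x) (p y) ≤ ENNReal.ofReal L * ‖x - y‖ₑ := by
  by_cases hxy : x = y
  · rw [hxy, W2_self]; exact zero_le
  · have h1 : W2 (p x) (p y) / ‖x - y‖ₑ ≤ ENNReal.ofReal L := by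
      rw [← h]
      exact le_iSup_of_le x (le_iSup₂_of_le y hxy le_rfl)
    rwa [ENNReal.div_le_iff (by simpa [sub_eq_zero] using hxy) (by simp)] at h1

lemma enorm_sub_le_lipDet_mul {S : State n → State n} {L : ℝ}
    (h : lipDet S = ENNReal.ofReal L) (x y : State n) :
    ‖S x - S y‖ₑ ≤ ENNReal.ofReal L * ‖x - y‖ₑ := by
  by_cases hxy : x = y
  · simp [hxy]
  · have h1 : ‖S x - S y‖ₑ / ‖x - y‖ₑ ≤ ENNReal.ofReal L := by
      rw [← h]
      exact le_iSup_of_le x (le_iSup₂_of_le y hxy le_rfl)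
    rwa [ENNReal.div_le_iff (by simpa [sub_eq_zero] using hxy) (by simp)] at h1

lemma marginal_deterministic {S : State n → State n} (hS : Measurable S) (μ₀ : Measure (State n))
    (t : ℕ) : marginal (Kernel.deterministic S hS) μ₀ t = marginalDet S μ₀ t := by
  induction t with
  | zero => rfl
  | succ t ih => rw [marginal, marginalDet, ih, Measure.deterministic_comp_eq_map]

/-- A finite `lipDet` makes `S` Lipschitz, hence measurable, so the recursion is the chain of a
Dirac kernel and the probabilistic bound applies. -/
lemma W2_marginalDet_le (T : Kernel (State n) (State n)) [IsMarkovKernel T]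
    (μ₀ : Measure (State n)) [IsProbabilityMeasure μ₀] {S : State n → State n} {L : ℝ}
    (hL : 1 < L) (h : lipDet S = ENNReal.ofReal L) (t : ℕ) :
    W2 (marginal T μ₀ t) (marginalDet S μ₀ t) ≤
      ENNReal.ofReal ((L ^ t - 1) / (L - 1)) * errDet T S := by
  have hlip : LipschitzWith L.toNNReal S := fun x y => by
    rw [edist_eq_enorm_sub, edist_eq_enorm_sub]
    exact enorm_sub_le_lipDet_mul h x y
  have hS : Measurable S := hlip.continuous.measurable
  rw [← marginal_deterministic hS]
  have key := W2_marginal_le T (Kernel.deterministic S hS) μ₀ (fun x => by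
    rw [Kernel.deterministic_apply, lintegral_dirac]; simp) hL (fun x y => by
    rw [Kernel.deterministic_apply, Kernel.deterministic_apply]
    exact (W2_dirac_dirac _ _).trans (enorm_sub_le_lipDet_mul h x y)) t
  simpa only [errProb, errDet, Kernel.deterministic_apply] using key

end Autoregressive

theorem proposition1 (n : ℕ) (T : Kernel (State n) (State n)) [IsMarkovKernel T]
    (μ₀ : Measure (State n)) [IsProbabilityMeasure μ₀] (Δt : ℝ) (hΔt : 0 < Δt) :
    -- the error bounds for a deterministic surrogate
    (∀ (S : State n → State n) (L : ℝ), 1 < L → lipDet S = ENNReal.ofReal L → ∀ t : ℕ,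
      W2 (marginal T μ₀ t) (marginalDet S μ₀ t)
          ≤ ENNReal.ofReal ((L ^ t - 1) / (L - 1)) * errDet T S ∧
      W2 (marginal T μ₀ t) (marginalDet S μ₀ t)
          ≤ ENNReal.ofReal ((Real.exp (growthRate L Δt * (t * Δt)) - 1) / growthRate L Δt)
              * (errDet T S / ENNReal.ofReal Δt)) ∧
    -- the error bounds for a probabilistic surrogate
    (∀ (p : Kernel (State n) (State n)) (_ : IsMarkovKernel p) (_ : ∀ x, MemLp id 2 (p x))
      (L : ℝ), 1 < L → lipProb p = ENNReal.ofReal L → ∀ t : ℕ,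
      W2 (marginal T μ₀ t) (marginal p μ₀ t)
          ≤ ENNReal.ofReal ((L ^ t - 1) / (L - 1)) * errProb T p ∧
      W2 (marginal T μ₀ t) (marginal p μ₀ t)
          ≤ ENNReal.ofReal ((Real.exp (growthRate L Δt * (t * Δt)) - 1) / growthRate L Δt)
              * (errProb T p / ENNReal.ofReal Δt)) ∧
    -- the one-step error of every deterministic surrogate is at least the intrinsic spread
    (∀ S : State n → State n, intrinsicSpread T ≤ errDet T S) ∧
    -- the intrinsic spread of a non-degenerate kernel is positive
    ((∃ x, 0 < totalVariance (T x)) → 0 < intrinsicSpread T) ∧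
    -- the one-step error of a probabilistic surrogate can be made arbitrarily small
    ((∀ x, MemLp id 2 (T x)) → ∀ δ : ℝ≥0∞, 0 < δ →
      ∃ p : Kernel (State n) (State n), IsMarkovKernel p ∧ (∀ x, MemLp id 2 (p x)) ∧
        errProb T p < δ) := by
  -- For the last claim the surrogate is `T` itself, with error 0.
  refine ⟨fun S L hL h t => ?_, fun p _ hp L hL h t => ?_, fun S => ?_, intrinsicSpread_pos T,
    fun hT δ hδ => ⟨T, inferInstance, hT, ?_⟩⟩
  · have key := W2_marginalDet_le T μ₀ hL h t
    exact ⟨key, key.trans (ofReal_geom_mul_le hL hΔt t _)⟩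
  · have key := W2_marginal_le T p μ₀ (fun x => lintegral_sq_lt_top_of_memLp (hp x)) hL
      (W2_le_lipProb_mul h) t
    exact ⟨key, key.trans (ofReal_geom_mul_le hL hΔt t _)⟩
  · exact iSup_mono fun x => iInf_le _ (S x)
  · simpa [errProb, W2_self] using hδ
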